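/- Let $d\ge 1$, $I_d=\{1,\dots,d\}$, let $\mathcal S^d=\{\theta\in\mathbb R^d:\theta^i\ge 0,\ \sum_i\theta^i=1\}$ be the probability simplex, and let $c:I_d\times\mathcal S^d\times(\mathbb R_0^+)^d\to\mathbb R$, $c(i,\theta,\alpha)$, be a running cost such that: - $c$ is Lipschitz in $\theta$ uniformly in $\alpha$; $c$ is differentiable in $\alpha$ on the closed orthant $(\mathbb R_0^+)^d$ (derivatives taken within the orthant); and $\nabla_\alpha c$ is Lipschitz in $\theta$ uniformly in $\alpha$; - $c(i,\theta,\alpha)$ does not depend on $\alpha_i$, and it is uniformly convex in the remaining coordinates: there is $\gamma>0$ with $c(i,\theta,\alpha')-c(i,\theta,\alpha)\ge\nabla_\alpha c(i,\theta,\alpha)\cdot(\alpha'-\alpha)+\gamma\sum_{j\ne i}(\alpha'_j-\alpha_j)^2$ for all $i,\theta,\alpha,\alpha'$; - for $j\neq i$, $c(i,\theta,\alpha)/\|\alpha\|\to\infty$ as $\alpha_j\to\infty$ with the other coordinates of $\alpha$ fixed. For $z\in\mathbb R^d$ put $\Delta_i z=(z^1-z^i,\dots,z^d-z^i)$ and $$h(z,\theta,i)=\min_{\mu\in(\mathbb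 R_0^+)^d}\big(c(i,\theta,\mu)+\mu\cdot\Delta_i z\big).$$ For $j\ne i$ let $\alpha^*_j(z,\theta,i)$ be the $j$-th coordinate (which is unique) of a minimizer, and put $\alpha_i^*(z,\theta,i)=-\sum_{j\ne i}\alpha_j^*(z,\theta,i)$. Let $\|v\|=\max_i|v^i|$, $\mathbf 1=(1,\dots,1)$ and $\|v\|_\sharp=\inf_{\lambda\in\mathbb R}\|v+\lambda\mathbf 1\|$. Consider the mean field game equations $$\frac{d\theta^i}{dt}=\sum_j\theta^j\,\alpha_i^*(\Delta_j u,\theta,j),\qquad -\frac{du^i}{dt}=h(\Delta_i u,\theta,i),\qquad i\in I_d, \tag{1}$$ whose solutions are trajectories $(u,\theta)$ with values in the phase space $\mathbb R^d\times\mathcal S^d$. Suppose that $h$ is contractive: there is $M>0$ such that for all $\theta\in\mathcal S^d$, all $i$, and all $u$ with $\|u\|_\sharp>M$, $$(\Delta_iu)^j\le0\ \ \forall j\ \Longrightarrow\ h(\Delta_iu,\theta,i)<\frac1d\sum_k h(u,\theta,k),\qquad (\Delta_iu)^j\ge0\ \ \forall j\ \Longrightarrow\ h(\Delta_iu,\theta,i)>\frac1d\sum_k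 h(u,\theta,k).$$ Then: (a) For all sufficiently large $M$, the set $A_M=\{u\in\mathbb R^d:\|u\|_\sharp<M\}\times\mathcal S^d$ is invariant backwards in time under (1): if $(u,\theta):[a,b]\to\mathbb R^d\times\mathcal S^d$ solves (1) and $(u(b),\theta(b))\in A_M$, then $(u(t),\theta(t))\in A_M$ for all $t\in[a,b]$. The threshold for $M$ depends only on $c$. (b) There is a stationary solution of (1), that is, a triple $(\bar\theta,\bar u,\kappa)\in\mathcal S^d\times\mathbb R^d\times\mathbb R$ with $$\sum_j\bar\theta^j\alpha_i^*(\Delta_j\bar u,\bar\theta,j)=0\quad\text{and}\quad h(\Delta_i\bar u,\bar\theta,i)=\kappa\qquad\text{for all } i\in I_d.$$ -/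

import Mathlib

open Set Filter Topology

noncomputable section

namespace MeanFieldGame

variable {d : ℕ}

/-- The admissible vectors of switching rates, `(ℝ₀⁺)^d`. -/
def orthant (d : ℕ) : Set (Fin d → ℝ) := {μ | ∀ j, 0 ≤ μ j}

/-- The difference operator `Δ_i z = (z^1 - z^i, …, z^d - z^i)`. -/
def diffOp (i : Fin d) (z : Fin d → ℝ) : Fin d → ℝ := fun j => z j - z i

/-- The norm `‖v‖_♯ = inf_l ‖v + l 𝟏‖` on `ℝ^d / ℝ`, where `‖·‖` is the maximum norm
(the norm that Mathlib puts on `Fin d → ℝ`). -/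
def sharpNorm (v : Fin d → ℝ) : ℝ := ⨅ l : ℝ, ‖v + fun _ => l‖

/-- The standing assumptions on a running cost `c : I_d × S^d × (ℝ₀⁺)^d → ℝ`.
The function is written on all of `ℝ^d × ℝ^d`, but only its values for `θ` in the simplex and `α` in
the closed orthant are ever used; derivatives in `α` are taken within the orthant. -/
structure IsRunningCost (c : Fin d → (Fin d → ℝ) → (Fin d → ℝ) → ℝ) : Prop where
  /-- `c` is Lipschitz in `θ`, uniformly in `α`. -/
  lipschitz : ∃ K : ℝ, ∀ i, ∀ θ ∈ stdSimplex ℝ (Fin d), ∀ θ' ∈ stdSimplex ℝ (Fin d),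
    ∀ α ∈ orthant d, |c i θ α - c i θ' α| ≤ K * ‖θ - θ'‖
  /-- `c` is differentiable in `α`. -/
  differentiable : ∀ i, ∀ θ ∈ stdSimplex ℝ (Fin d), DifferentiableOn ℝ (c i θ) (orthant d)
  /-- `∂c/∂α` is Lipschitz in `θ`, uniformly in `α`. -/
  lipschitz_deriv : ∃ K : ℝ, ∀ i, ∀ θ ∈ stdSimplex ℝ (Fin d), ∀ θ' ∈ stdSimplex ℝ (Fin d),
    ∀ α ∈ orthant d,
      ‖fderivWithin ℝ (c i θ) (orthant d) α - fderivWithin ℝ (c i θ') (orthant d) α‖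
        ≤ K * ‖θ - θ'‖
  /-- `c i θ α` does not depend on the coordinate `α_i`. -/
  indep : ∀ i, ∀ θ ∈ stdSimplex ℝ (Fin d), ∀ α ∈ orthant d, ∀ α' ∈ orthant d,
    (∀ j, j ≠ i → α j = α' j) → c i θ α = c i θ α'
  /-- `c` is uniformly convex in the coordinates `α_j`, `j ≠ i`. -/
  uniform_convex : ∃ γ : ℝ, 0 < γ ∧ ∀ i, ∀ θ ∈ stdSimplex ℝ (Fin d),
    ∀ α ∈ orthant d, ∀ α' ∈ orthant d,
      fderivWithin ℝ (c i θ) (orthant d) α (α' - α)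
          + γ * ∑ j ∈ Finset.univ.erase i, (α' j - α j) ^ 2
        ≤ c i θ α' - c i θ α
  /-- `c` is superlinear in each `α_j`, `j ≠ i`. -/
  superlinear : ∀ i, ∀ θ ∈ stdSimplex ℝ (Fin d), ∀ α ∈ orthant d, ∀ j, j ≠ i →
    Tendsto (fun s : ℝ => c i θ (Function.update α j s) / ‖Function.update α j s‖) atTop atTop

/-- The function `μ ↦ c(i,θ,μ) + μ · Δ_i z` that is minimized over the orthant. -/
def hamiltonianCost (c : Fin d → (Fin d → ℝ) → (Fin d → ℝ) → ℝ) (z θ : Fin d → ℝ) (i : Fin d)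
    (μ : Fin d → ℝ) : ℝ :=
  c i θ μ + ∑ j, μ j * diffOp i z j

/-- The generalized Legendre transform `h(z,θ,i) = min_{μ ∈ (ℝ₀⁺)^d} c(i,θ,μ) + μ · Δ_i z`.
(For a running cost the infimum is attained.) -/
def h (c : Fin d → (Fin d → ℝ) → (Fin d → ℝ) → ℝ) (z θ : Fin d → ℝ) (i : Fin d) : ℝ :=
  sInf (hamiltonianCost c z θ i '' orthant d)

open Classical in
/-- A minimizer over the orthant of `μ ↦ c(i,θ,μ) + μ · Δ_i z`. For a running cost a minimizer
exists, and its coordinates other than the `i`-th are unique; the value `0` is never used then. -/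
def argminRate (c : Fin d → (Fin d → ℝ) → (Fin d → ℝ) → ℝ) (z θ : Fin d → ℝ) (i : Fin d) :
    Fin d → ℝ :=
  if H : ∃ μ ∈ orthant d, IsMinOn (hamiltonianCost c z θ i) (orthant d) μ then H.choose else 0

/-- The optimal rates: `αStar c z θ i j` is `α*_j(z,θ,i)`, the minimizer for `j ≠ i`, and
`α*_i(z,θ,i) = - ∑_{k ≠ i} α*_k(z,θ,i)`. -/
def αStar (c : Fin d → (Fin d → ℝ) → (Fin d → ℝ) → ℝ) (z θ : Fin d → ℝ) (i j : Fin d) : ℝ :=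
  if j = i then - ∑ k ∈ Finset.univ.erase i, argminRate c z θ i k else argminRate c z θ i j

/-- `h` is contractive; `⟨h(u,θ,·)⟩` is the average over the `d` states. -/
def IsContractive (c : Fin d → (Fin d → ℝ) → (Fin d → ℝ) → ℝ) : Prop :=
  ∃ M : ℝ, 0 < M ∧ ∀ θ ∈ stdSimplex ℝ (Fin d), ∀ (i : Fin d) (u : Fin d → ℝ), M < sharpNorm u →
    ((∀ j, diffOp i u j ≤ 0) → h c (diffOp i u) θ i - (1 / (d : ℝ)) * ∑ j, h c u θ j < 0) ∧
    ((∀ j, 0 ≤ diffOp i u j) → 0 < h c (diffOp i u) θ i - (1 / (d : ℝ)) * ∑ j, h c u θ j)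

/-- `(θ, u) : [a, b] → S^d × ℝ^d` is a solution of the mean field game equations
`dθ^i/dt = ∑_j θ^j α*_i(Δ_j u, θ, j)`, `- du^i/dt = h(Δ_i u, θ, i)`.
The equations only make sense for `θ(t) ∈ S^d`, so the phase space is `ℝ^d × S^d`. -/
structure IsSolution (c : Fin d → (Fin d → ℝ) → (Fin d → ℝ) → ℝ) (a b : ℝ)
    (θ u : ℝ → Fin d → ℝ) : Prop where
  mem_simplex : ∀ t ∈ Icc a b, θ t ∈ stdSimplex ℝ (Fin d)
  kolmogorov : ∀ t ∈ Icc a b, ∀ i, HasDerivWithinAt (fun s => θ s i)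
    (∑ j, θ t j * αStar c (diffOp j (u t)) (θ t) j i) (Icc a b) t
  hamiltonJacobi : ∀ t ∈ Icc a b, ∀ i, HasDerivWithinAt (fun s => u s i)
    (- h c (diffOp i (u t)) (θ t) i) (Icc a b) t

/-- A subset `A` of the phase space is invariant backwards in time: a trajectory that lies in `A`
at some time lies in `A` at all earlier times at which it is defined. -/
def IsBackwardInvariant (c : Fin d → (Fin d → ℝ) → (Fin d → ℝ) → ℝ)
    (A : Set ((Fin d → ℝ) × (Fin d → ℝ))) : Prop :=
  ∀ (a b : ℝ) (θ u : ℝ → Fin d → ℝ), a ≤ b → IsSolution c a b θ u →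
    (u b, θ b) ∈ A → ∀ t ∈ Icc a b, (u t, θ t) ∈ A

/-- `(θ, u, κ) ∈ S^d × ℝ^d × ℝ` is a stationary solution of the mean field game equations. -/
structure IsStationarySolution (c : Fin d → (Fin d → ℝ) → (Fin d → ℝ) → ℝ)
    (θ u : Fin d → ℝ) (κ : ℝ) : Prop where
  mem_simplex : θ ∈ stdSimplex ℝ (Fin d)
  kolmogorov : ∀ i, ∑ j, θ j * αStar c (diffOp j u) θ j i = 0
  hamiltonJacobi : ∀ i, h c (diffOp i u) θ i = κ

end MeanFieldGame

end

/-! Invariance is a maximum-principle argument. The norm `sharpNorm u` is half the gap between the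
largest and the smallest coordinate of `u`. If coordinates `i` and `j` attain them and the norm
exceeds the contractivity level, then `h` at `i` lies below the average and `h` at `j` above it, so
`u i - u j` has positive derivative. At the last time at which the norm is at least `M`, this
contradicts the norm being below `M` immediately afterwards.

A stationary solution is a fixed point on a box times the simplex. The value `u` is moved by `h`
minus its average and truncated to the box; `θ` is moved by the positive part of its inflow and
renormalized, as in Nash's proof. If some component of the value field were nonzero, then, since the
components sum to zero, both signs would occur and truncation would put `u` at opposite faces of the
box. There `sharpNorm u` is large and contractivity gives the wrong sign. The inflow also sums to
zero and is nonnegative at empty states, so proportionality of its positive part to `θ` makes it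
vanish.

Continuity of the fields comes from uniform convexity: the Hamiltonian cost grows quadratically away
from a minimizer, which makes the minimizers stable in `z` and `θ`. Brouwer's theorem is obtained
from Scarf's combinatorial lemma applied to finer and finer grids. -/

namespace Scarf

/-! ### Scarf's lemma on dominant sets -/

variable {X I L : Type*} [LinearOrder L]

/-- A finite set is dominant for a family of orders if no point lies above the minimum of the set
for all orders simultaneously. -/
def IsDominant (g : I → X → L) (σ : Finset X) : Prop :=
  ∀ y, ∃ i, ∀ x ∈ σ, g i y ≤ g i x

theorem IsDominant.mono {g : I → X → L} {σ τ : Finset X} (h : IsDominant g σ) (hτ : τ ⊆ σ) :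
    IsDominant g τ := fun y =>
  let ⟨i, hi⟩ := h y
  ⟨i, fun x hx => hi x (hτ hx)⟩

variable [DecidableEq X] [Fintype I] [DecidableEq I]

/-- In a set without all colours, the one-point deletions that show exactly the colours other than
`i₀` are even in number. -/
theorem even_card_deletions (c : X → I) (i₀ : I) {σ : Finset X} (hσ : σ.card = Fintype.card I)
    (hc : σ.image c ≠ Finset.univ) :
    Even {τ ∈ σ.powerset | τ.card + 1 = Fintype.card I ∧ τ.image c = Finset.univ.erase i₀}.card := by
  set F := {τ ∈ σ.powerset | τ.card + 1 = Fintype.card I ∧ τ.image c = Finset.univ.erase i₀} with hF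
  rcases F.eq_empty_or_nonempty with h | ⟨τ, hτ⟩
  · rw [h]; simp
  simp only [hF, Finset.mem_filter, Finset.mem_powerset] at hτ
  obtain ⟨hτσ, hτcard, hτc⟩ := hτ
  obtain ⟨x, hx, rfl⟩ := Finset.exists_eq_insert_iff.2 ⟨hτσ, hτcard.trans hσ.symm⟩
  have hinj : Set.InjOn c τ := by
    apply Finset.card_image_iff.1
    rw [hτc, Finset.card_erase_of_mem (Finset.mem_univ _), Finset.card_univ]; omega
  have hcx : c x ≠ i₀ := by
    intro h
    apply hc
    rw [Finset.image_insert, hτc, h, Finset.insert_erase (Finset.mem_univ _)]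
  -- The added point repeats the colour of exactly one `x'` in `τ`; dropping `x` or `x'` gives the
  -- only two deletions.
  obtain ⟨x', hx', hcx'⟩ : ∃ x' ∈ τ, c x' = c x := by
    have : c x ∈ τ.image c := by rw [hτc]; simpa using hcx
    simpa using this
  have hxx' : x' ≠ x := by rintro rfl; exact hx hx'
  have hx'c : (insert x (τ.erase x')).image c = τ.image c := by
    conv_rhs => rw [← Finset.insert_erase hx']
    rw [Finset.image_insert, Finset.image_insert, hcx']
  have : F = {τ, insert x (τ.erase x')} := by
    ext ρ
    simp only [hF, Finset.mem_filter, Finset.mem_powerset, Finset.mem_insert,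
      Finset.mem_singleton]
    constructor
    · rintro ⟨hρ, hρcard, hρc⟩
      obtain ⟨y, hy, hyρ⟩ := Finset.exists_eq_insert_iff.2 ⟨hρ, hρcard.trans hσ.symm⟩
      have hρe : ρ = (insert x τ).erase y := by rw [← hyρ, Finset.erase_insert hy]
      have hyσ : y ∈ insert x τ := by rw [← hyρ]; exact Finset.mem_insert_self _ _
      by_cases hyx : y = x
      · left; rw [hρe, hyx, Finset.erase_insert hx]
      right
      have hyτ : y ∈ τ := (Finset.mem_insert.1 hyσ).resolve_left hyx
      have : y = x' := by
        have hcy : c y ∈ ρ.image c := by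
          rw [hρc, ← hτc]; exact Finset.mem_image_of_mem c hyτ
        obtain ⟨z, hz, hzy⟩ := Finset.mem_image.1 hcy
        rw [hρe] at hz
        obtain ⟨hzy', hz⟩ := Finset.mem_erase.1 hz
        rcases Finset.mem_insert.1 hz with rfl | hz
        · exact hinj hyτ hx' (by rw [hcx', hzy])
        · exact absurd (hinj hz hyτ hzy) hzy'
      rw [hρe, this, Finset.erase_insert_of_ne hxx'.symm]
    · rintro (rfl | rfl)
      · exact ⟨hτσ, hτcard, hτc⟩
      · refine ⟨Finset.insert_subset_insert _ (Finset.erase_subset _ _), ?_, hx'c.trans hτc⟩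
        rw [Finset.card_insert_of_notMem (fun h => hx (Finset.mem_of_mem_erase h)),
          Finset.card_erase_add_one hx', hτcard]
  rw [this, Finset.card_pair]
  · exact even_two
  · intro h
    apply hx
    rw [h]; exact Finset.mem_insert_self _ _

variable [Fintype X]

/-- A dominant set with one element less than there are orders, all of whose minima are exceeded
in the other orders by some point, has exactly two dominant one-point extensions. -/
theorem exists_two_extensions {g : I → X → L} (hg : ∀ i, Function.Injective (g i)) {τ : Finset X}
    (hτ : IsDominant g τ) (hcard : τ.card + 1 = Fintype.card I) (hne : τ.Nonempty)
    (hext : ∀ j, ∃ y, ∀ i ≠ j, ∃ x ∈ τ, g i x < g i y) :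
    ∃ p q, p ≠ q ∧ ∀ x, (x ∉ τ ∧ IsDominant g (insert x τ)) ↔ x = p ∨ x = q := by
  have hmin : ∀ i, ∃ x ∈ τ, ∀ y ∈ τ, g i x ≤ g i y := fun i => τ.exists_min_image (g i) hne
  choose m hmτ hm using hmin
  have hsurj : ∀ y ∈ τ, ∃ i, m i = y := by
    intro y hy
    obtain ⟨i, hi⟩ := hτ y
    exact ⟨i, hg i (le_antisymm (hm i y hy) (hi _ (hmτ i)))⟩
  have hmem : ∀ j y, (∀ i ≠ j, g i (m i) < g i y) → g j y ≤ g j (m j) := by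
    intro j y hy
    obtain ⟨i, hi⟩ := hτ y
    by_cases hij : i = j
    · subst hij; exact hi _ (hmτ i)
    · exact absurd (hi _ (hmτ i)) (not_le.2 (hy i hij))
  -- Every point of `τ` is the minimum `m i` for some order, and there is one order more than
  -- points, so exactly one pair of orders shares its minimum.
  obtain ⟨a, -, b, -, hab, hmab⟩ : ∃ a ∈ (Finset.univ : Finset I), ∃ b ∈ Finset.univ,
      a ≠ b ∧ m a = m b :=
    Finset.exists_ne_map_eq_of_card_lt_of_maps_to (t := τ)
      (by rw [Finset.card_univ]; omega) (fun i _ => hmτ i)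
  have hinj : ∀ a b, a ≠ b → m a = m b → ∀ i i', i ≠ a → i' ≠ a → m i = m i' → i = i' := by
    intro a b hab hmab
    have himg : (Finset.univ.erase a).image m = τ := by
      ext y
      simp only [Finset.mem_image, Finset.mem_erase, Finset.mem_univ, and_true]
      constructor
      · rintro ⟨i, -, rfl⟩; exact hmτ i
      · intro hy
        obtain ⟨i, rfl⟩ := hsurj y hy
        by_cases hi : i = a
        · exact ⟨b, hab.symm, by rw [hi, hmab]⟩
        · exact ⟨i, hi, rfl⟩
    have hc : ((Finset.univ.erase a).image m).card = (Finset.univ.erase a).card := by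
      rw [himg, Finset.card_erase_of_mem (Finset.mem_univ a), Finset.card_univ]; omega
    have := Finset.card_image_iff.1 hc
    intro i i' hi hi' h
    exact this (by simpa using hi) (by simpa using hi') h
  -- `w j` will be the `j`-largest point above the minima of all other orders. The two extensions
  -- are `w a` and `w b`.
  have hmax : ∀ j, ∃ x, (∀ i ≠ j, g i (m i) < g i x) ∧
      ∀ y, (∀ i ≠ j, g i (m i) < g i y) → g j y ≤ g j x := by
    intro j
    obtain ⟨y, hy⟩ := hext j
    have hy' : ∀ i ≠ j, g i (m i) < g i y := by
      intro i hi
      obtain ⟨x, hx, hxy⟩ := hy i hi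
      exact (hm i x hx).trans_lt hxy
    obtain ⟨x, hx, hx'⟩ := (Finset.univ.filter fun y => ∀ i ≠ j, g i (m i) < g i y).exists_max_image
      (g j) ⟨y, by simpa using hy'⟩
    refine ⟨x, by simpa using hx, fun y hy => hx' y (by simpa using hy)⟩
  choose w hw hwmax using hmax
  have hext' : ∀ a b, a ≠ b → m a = m b → w a ∉ τ ∧ IsDominant g (insert (w a) τ) := by
    intro a b hab hmab
    constructor
    · intro h
      obtain ⟨i, hi⟩ := hsurj _ h
      by_cases hia : i = a
      · have := hw a b hab.symm
        rw [← hi, hia, hmab] at this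
        exact lt_irrefl _ this
      · have := hw a i hia
        rw [hi] at this
        exact lt_irrefl _ this
    · intro y
      by_cases hy : ∀ i ≠ a, g i (m i) < g i y
      · refine ⟨a, fun x hx => ?_⟩
        rcases Finset.mem_insert.1 hx with rfl | hx
        · exact hwmax a y hy
        · exact (hmem a y hy).trans (hm a x hx)
      · push Not at hy
        obtain ⟨i, hia, hi⟩ := hy
        refine ⟨i, fun x hx => ?_⟩
        rcases Finset.mem_insert.1 hx with rfl | hx
        · exact hi.trans (hw a i hia).le
        · exact hi.trans (hm i x hx)
  refine ⟨w a, w b, ?_, fun x => ⟨?_, ?_⟩⟩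
  · intro h
    obtain ⟨i, hi⟩ := hτ (w a)
    refine absurd (hi _ (hmτ i)) (not_le.2 ?_)
    by_cases hia : i = a
    · rw [h]; exact hw b i (by rw [hia]; exact hab)
    · exact hw a i hia
  · rintro ⟨hx, hdom⟩
    obtain ⟨j, hj⟩ := hdom x
    -- The new point takes over the minimum in order `j`, while each old point must remain the
    -- minimum of another order. Hence `j` belongs to the shared pair.
    have hz : ∀ z ∈ τ, ∃ i, i ≠ j ∧ m i = z ∧ g i (m i) < g i x := by
      intro z hz
      obtain ⟨i, hi⟩ := hdom z
      have hiz : m i = z :=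
        hg i (le_antisymm (hm i z hz) (hi _ (Finset.mem_insert_of_mem (hmτ i))))
      have hlt : g i (m i) < g i x := by
        refine lt_of_le_of_ne (hiz ▸ hi x (Finset.mem_insert_self _ _)) fun h => hx ?_
        rw [← hg i h]; exact hmτ i
      refine ⟨i, ?_, hiz, hlt⟩
      rintro rfl
      exact absurd (hj (m i) (Finset.mem_insert_of_mem (hmτ i))) (not_le.2 hlt)
    have hjab : j = a ∨ j = b := by
      by_contra hcon
      push Not at hcon
      obtain ⟨i, hij, hi, -⟩ := hz (m j) (hmτ j)
      by_cases hia : i = a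
      · exact hij (hinj b a hab.symm hmab.symm i j (by rw [hia]; exact hab) hcon.2 hi)
      · exact hij (hinj a b hab hmab i j hia hcon.1 hi)
    have key : ∀ a b, a ≠ b → m a = m b → j = a → x = w a := by
      rintro a b hab hmab rfl
      have hxM : ∀ i ≠ j, g i (m i) < g i x := by
        intro i hij
        obtain ⟨i', hi'j, hi', hlt⟩ := hz (m i) (hmτ i)
        rwa [hinj j b hab hmab i' i hi'j hij hi'] at hlt
      refine hg j (le_antisymm (hwmax j x hxM) ?_)
      obtain ⟨i, hi⟩ := hdom (w j)
      by_cases hij : i = j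
      · subst hij; exact hi x (Finset.mem_insert_self _ _)
      · exact absurd (hi _ (Finset.mem_insert_of_mem (hmτ i))) (not_le.2 (hw j i hij))
    rcases hjab with h | h
    · exact Or.inl (key a b hab hmab h)
    · exact Or.inr (key b a hab.symm hmab.symm h)
  · rintro (rfl | rfl)
    · exact hext' a b hab hmab
    · exact hext' b a hab.symm hmab.symm

/-- **Scarf's lemma**, with one slack point `e i` for every order. -/
theorem exists_isDominant_image_eq_univ {g : I → X → L} (hg : ∀ i, Function.Injective (g i))
    {e : I → X} (he : ∀ i x, x ≠ e i → g i (e i) < g i x)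
    (he' : ∀ i j x, j ≠ i → x ∉ Set.range e → g i x < g i (e j))
    (c : X → I) (hce : ∀ i, c (e i) = i) [Nonempty I] :
    ∃ σ : Finset X, IsDominant g σ ∧ σ.image c = Finset.univ := by
  classical
  by_contra! hcon
  obtain ⟨i₀⟩ := ‹Nonempty I›
  have heinj : Function.Injective e := fun i j h => by rw [← hce i, h, hce]
  -- Double counting of inclusions of doors in rooms: without a fully coloured room each room has an
  -- even number of doors, and each door lies in two rooms, except `τ₀`, which lies in one.
  let rooms : Finset (Finset X) := {σ | σ.card = Fintype.card I ∧ IsDominant g σ}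
  let doors : Finset (Finset X) := {τ | τ.card + 1 = Fintype.card I ∧ IsDominant g τ ∧
    τ.image c = Finset.univ.erase i₀}
  let τ₀ : Finset X := (Finset.univ.erase i₀).image e
  have hτ₀mem : ∀ x, x ∈ τ₀ ↔ ∃ i, i ≠ i₀ ∧ e i = x := by intro x; simp [τ₀]
  have hτ₀card : τ₀.card + 1 = Fintype.card I := by
    rw [Finset.card_image_of_injective _ heinj,
      Finset.card_erase_add_one (Finset.mem_univ _), Finset.card_univ]
  have hτ₀c : τ₀.image c = Finset.univ.erase i₀ := by
    rw [Finset.image_image]; ext; simp [hce]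
  have hge : ∀ i x, g i (e i) ≤ g i x := by
    intro i x
    by_cases h : x = e i
    · rw [h]
    · exact (he i x h).le
  have hout : ∀ y, y ∉ τ₀ → ∀ z ∈ τ₀, g i₀ y ≤ g i₀ z := by
    intro y hy z hz
    obtain ⟨i, hi, rfl⟩ := (hτ₀mem z).1 hz
    by_cases hyr : y ∈ Set.range e
    · obtain ⟨j, rfl⟩ := hyr
      have : j = i₀ := by
        by_contra h; exact hy ((hτ₀mem _).2 ⟨j, h, rfl⟩)
      rw [this]; exact hge _ _
    · exact (he' i₀ i y hi hyr).le
  have hτ₀dom : IsDominant g τ₀ := by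
    intro y
    by_cases hy : y ∈ τ₀
    · obtain ⟨i, hi, rfl⟩ := (hτ₀mem y).1 hy
      exact ⟨i, fun x _ => hge i x⟩
    · exact ⟨i₀, hout y hy⟩
  have hτ₀ : τ₀ ∈ doors := by simp [doors, hτ₀card, hτ₀dom, hτ₀c]
  have hcount := Finset.sum_card_bipartiteAbove_eq_sum_card_bipartiteBelow
    (s := rooms) (t := doors) (fun σ τ => τ ⊆ σ)
  have hrooms : Even (∑ σ ∈ rooms, (doors.bipartiteAbove (fun σ τ => τ ⊆ σ) σ).card) := by
    refine Finset.even_sum _ fun σ hσ => ?_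
    simp only [rooms, Finset.mem_filter, Finset.mem_univ, true_and] at hσ
    suffices h : doors.bipartiteAbove (fun σ τ => τ ⊆ σ) σ = {τ ∈ σ.powerset |
        τ.card + 1 = Fintype.card I ∧ τ.image c = Finset.univ.erase i₀} by
      rw [h]; exact even_card_deletions c i₀ hσ.1 (hcon σ hσ.2)
    ext τ
    simp only [Finset.bipartiteAbove, doors, Finset.mem_filter, Finset.mem_univ, true_and,
      Finset.mem_powerset]
    constructor
    · rintro ⟨⟨h1, h2, h3⟩, h4⟩; exact ⟨h4, h1, h3⟩
    · rintro ⟨h4, h1, h3⟩; exact ⟨⟨h1, hσ.2.mono h4, h3⟩, h4⟩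
  have hbelow : ∀ τ ∈ doors, ∀ p q : X,
      (∀ x, (x ∉ τ ∧ IsDominant g (insert x τ)) ↔ x = p ∨ x = q) →
      rooms.bipartiteBelow (fun σ τ => τ ⊆ σ) τ = {insert p τ, insert q τ} := by
    intro τ hτ p q hpq
    simp only [doors, Finset.mem_filter, Finset.mem_univ, true_and] at hτ
    ext σ
    simp only [Finset.bipartiteBelow, rooms, Finset.mem_filter, Finset.mem_univ, true_and,
      Finset.mem_insert, Finset.mem_singleton]
    constructor
    · rintro ⟨⟨h1, h2⟩, h3⟩
      obtain ⟨x, hx, rfl⟩ := Finset.exists_eq_insert_iff.2 ⟨h3, hτ.1.trans h1.symm⟩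
      rcases (hpq x).1 ⟨hx, h2⟩ with rfl | rfl
      · exact Or.inl rfl
      · exact Or.inr rfl
    · have key : ∀ x, x = p ∨ x = q → (((insert x τ).card = Fintype.card I ∧
          IsDominant g (insert x τ)) ∧ τ ⊆ insert x τ) := fun x hx =>
        have h := (hpq x).2 hx
        ⟨⟨by rw [Finset.card_insert_of_notMem h.1, hτ.1], h.2⟩, Finset.subset_insert _ _⟩
      rintro (rfl | rfl)
      · exact key p (Or.inl rfl)
      · exact key q (Or.inr rfl)
  have hdoors : Even (∑ τ ∈ doors.erase τ₀,
      (rooms.bipartiteBelow (fun σ τ => τ ⊆ σ) τ).card) := by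
    refine Finset.even_sum _ fun τ hτ' => ?_
    obtain ⟨hne, hτd⟩ := Finset.mem_erase.1 hτ'
    have hτ := hτd
    simp only [doors, Finset.mem_filter, Finset.mem_univ, true_and] at hτ
    -- `τ₀` is the only door made of slack points alone. In any other door, a non-slack `t` lies
    -- below `e j` in every order `i ≠ j`, as the two-extension lemma requires.
    obtain ⟨t, ht, htr⟩ : ∃ t ∈ τ, t ∉ Set.range e := by
      by_contra! hall
      apply hne
      refine Finset.eq_of_subset_of_card_le (fun x hx => ?_) (by omega)
      obtain ⟨i, rfl⟩ := hall x hx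
      refine (hτ₀mem _).2 ⟨i, ?_, rfl⟩
      have : c (e i) ∈ τ.image c := Finset.mem_image_of_mem c hx
      rw [hτ.2.2, hce] at this
      exact (Finset.mem_erase.1 this).1
    obtain ⟨p, q, hpq, h⟩ := exists_two_extensions hg hτ.2.1 hτ.1 ⟨t, ht⟩
      (fun j => ⟨e j, fun i hi => ⟨t, ht, he' i j t hi.symm htr⟩⟩)
    rw [hbelow τ hτd p q h, Finset.card_pair]
    · exact even_two
    · intro hins
      have hp := ((h p).2 (Or.inl rfl)).1
      have : p ∈ insert q τ := by rw [← hins]; exact Finset.mem_insert_self _ _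
      rcases Finset.mem_insert.1 this with h' | h'
      · exact hpq h'
      · exact hp h'
  have hboundary : (rooms.bipartiteBelow (fun σ τ => τ ⊆ σ) τ₀).card = 1 := by
    have hei₀ : e i₀ ∉ τ₀ := by
      intro h
      obtain ⟨i, hi, hi'⟩ := (hτ₀mem _).1 h
      exact hi (heinj hi')
    -- Only the `i₀`-largest point outside `τ₀` extends it dominantly: in every other order the
    -- minimum is already a slack point of `τ₀`.
    obtain ⟨p, hp, hpmax⟩ := (Finset.univ \ τ₀).exists_max_image (g i₀) ⟨e i₀, by simpa using hei₀⟩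
    have hp' : p ∉ τ₀ := by simpa using hp
    rw [hbelow τ₀ hτ₀ p p ?_]
    · simp
    intro x
    rw [or_self]
    constructor
    · rintro ⟨hx, hdom⟩
      refine hg i₀ (le_antisymm (hpmax x (by simpa using hx)) ?_)
      obtain ⟨i, hi⟩ := hdom p
      by_cases hii : i = i₀
      · rw [← hii]; exact hi x (Finset.mem_insert_self _ _)
      · have hei : e i ∈ τ₀ := (hτ₀mem _).2 ⟨i, hii, rfl⟩
        have hpe : p ≠ e i := by rintro rfl; exact hp' hei
        exact absurd (hi (e i) (Finset.mem_insert_of_mem hei)) (not_le.2 (he i p hpe))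
    · rintro rfl
      refine ⟨hp', fun y => ?_⟩
      by_cases hy : y ∈ τ₀
      · obtain ⟨i, hi, rfl⟩ := (hτ₀mem y).1 hy
        exact ⟨i, fun x _ => hge i x⟩
      · refine ⟨i₀, fun x hx => ?_⟩
        rcases Finset.mem_insert.1 hx with rfl | hx
        · exact hpmax y (by simpa using hy)
        · exact hout y hy x hx
  rw [← Finset.sum_erase_add _ _ hτ₀, hboundary] at hcount
  rw [hcount] at hrooms
  exact absurd hdoors (by rwa [Nat.even_add_one] at hrooms)

end Scarf

/-! ### Brouwer's theorem on the simplex -/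

section Brouwer

variable {ι : Type*} [Fintype ι]

/-- The points of the simplex with coordinates in `{0, 1/N, …, 1}`, scaled by `N`. -/
abbrev SimplexGrid (ι : Type*) [Fintype ι] (N : ℕ) : Type _ :=
  {k : ι → Fin (N + 1) // ∑ i, (k i : ℕ) = N}

theorem SimplexGrid.exists_of_sum_eq {N : ℕ} (k : ι → ℕ) (hk : ∑ i, k i = N) :
    ∃ y : SimplexGrid ι N, ∀ i, (y.1 i : ℕ) = k i := by
  have hle : ∀ i, k i < N + 1 := fun i =>
    Nat.lt_succ_of_le (hk ▸ Finset.single_le_sum (fun _ _ => Nat.zero_le _) (Finset.mem_univ i))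
  exact ⟨⟨fun i => ⟨k i, hle i⟩, hk⟩, fun _ => rfl⟩

theorem SimplexGrid.div_mem_stdSimplex {N : ℕ} (hN : 0 < N) (k : SimplexGrid ι N) :
    (fun i => ((k.1 i : ℕ) : ℝ) / N) ∈ stdSimplex ℝ ι := by
  refine ⟨fun i => by positivity, ?_⟩
  rw [← Finset.sum_div, ← Nat.cast_sum, k.2, div_self]
  positivity

variable [DecidableEq ι]

/-- Scarf's lemma on the grid: a colouring of the grid points has a set of nearby grid points that
carry every colour `i`, except for those `i` whose coordinate is small on the set. -/
theorem SimplexGrid.exists_nearby_colours [Nonempty ι] {N : ℕ} (col : SimplexGrid ι N → ι) :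
    ∃ k : ι → SimplexGrid ι N,
      (∀ i j l, ((k i).1 l : ℕ) ≤ (k j).1 l + Fintype.card ι) ∧
      ∀ i, col (k i) = i ∨ ((k i).1 i : ℕ) ≤ Fintype.card ι := by
  classical
  let X := SimplexGrid ι N ⊕ ι
  -- Grid values lie in `1, …, N + 1`, so the slack point of `i` is below them in order `i` and the
  -- other slack points are above. Ties are broken by an enumeration.
  let v : ι → X → ℕ := fun i => Sum.elim (fun k => (k.1 i : ℕ) + 1)
    (fun j => if j = i then 0 else N + 2)
  let g : ι → X → ℕ ×ₗ Fin (Fintype.card X) := fun i x => toLex (v i x, Fintype.equivFin X x)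
  have hg : ∀ i, Function.Injective (g i) := by
    intro i x y h
    have h' : (v i x, Fintype.equivFin X x) = (v i y, Fintype.equivFin X y) := toLex.injective h
    exact (Fintype.equivFin X).injective (Prod.ext_iff.1 h').2
  have hlt : ∀ i x y, v i x < v i y → g i x < g i y := fun i x y h =>
    Prod.Lex.toLex_lt_toLex.2 (Or.inl h)
  have hle : ∀ i x y, g i x ≤ g i y → v i x ≤ v i y := fun i x y h => by
    rcases Prod.Lex.toLex_le_toLex.1 h with h | h
    · exact h.le
    · exact h.1.le
  obtain ⟨σ, hσ, hσc⟩ := Scarf.exists_isDominant_image_eq_univ hg (e := Sum.inr)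
    (by
      rintro i (k | j) hx
      · exact hlt _ _ _ (by simp [v])
      · exact hlt _ _ _ (by
          have : j ≠ i := fun h => hx (by rw [h])
          simp [v, this]))
    (by
      rintro i j (k | j') hij hx
      · exact hlt _ _ _ (by have := (k.1 i).2; simp [v, hij]; omega)
      · exact absurd ⟨j', rfl⟩ hx)
    (Sum.elim col id) (fun i => rfl)
  have hdom : ∀ y : SimplexGrid ι N, ∃ i, Sum.inr i ∉ σ ∧
      ∀ k : SimplexGrid ι N, Sum.inl k ∈ σ → (y.1 i : ℕ) ≤ k.1 i := by
    intro y
    obtain ⟨i, hi⟩ := hσ (Sum.inl y)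
    refine ⟨i, fun h => ?_, fun k hk => ?_⟩
    · have := hle _ _ _ (hi _ h)
      simp [v] at this
    · have := hle _ _ _ (hi _ hk)
      simpa [v] using this
  have hcol : ∀ i, Sum.inr i ∉ σ → ∃ k : SimplexGrid ι N, Sum.inl k ∈ σ ∧ col k = i := by
    intro i hi
    have : i ∈ σ.image (Sum.elim col id) := by rw [hσc]; exact Finset.mem_univ i
    obtain ⟨x, hx, hxi⟩ := Finset.mem_image.1 this
    rcases x with k | j
    · exact ⟨k, hx, hxi⟩
    · have : j = i := hxi
      exact absurd (this ▸ hx) hi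
  obtain ⟨y₀, -⟩ := SimplexGrid.exists_of_sum_eq (N := N)
    (Pi.single (Classical.arbitrary ι) N) (by simp)
  obtain ⟨i₁, hi₁, -⟩ := hdom y₀
  obtain ⟨k₀, hk₀, -⟩ := hcol i₁ hi₁
  have hmin : ∀ i, ∃ k : SimplexGrid ι N, Sum.inl k ∈ σ ∧
      ∀ k' : SimplexGrid ι N, Sum.inl k' ∈ σ → (k.1 i : ℕ) ≤ k'.1 i := by
    intro i
    obtain ⟨k, hk, hk'⟩ := (Finset.univ.filter fun k : SimplexGrid ι N => Sum.inl k ∈ σ).exists_min_image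
      (fun k => (k.1 i : ℕ)) ⟨k₀, by simpa using hk₀⟩
    exact ⟨k, by simpa using hk, fun k' h => hk' k' (by simpa using h)⟩
  choose km hkm hkm' using hmin
  -- `b` bounds the grid points of `σ` from below, and `b'` exceeds the bound by one in each order
  -- without slack point. If `∑ b' ≤ N`, a grid point above `b'` would violate dominance; so `b`
  -- almost exhausts the mass `N` and the grid points are close together.
  let b : ι → ℕ := fun i => if Sum.inr i ∈ σ then 0 else (km i).1 i
  let b' : ι → ℕ := fun i => if Sum.inr i ∈ σ then 0 else (km i).1 i + 1
  have hbk : ∀ k : SimplexGrid ι N, Sum.inl k ∈ σ → ∀ i, b i ≤ k.1 i := by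
    intro k hk i
    by_cases h : Sum.inr i ∈ σ
    · simp [b, h]
    · simpa [b, h] using hkm' i k hk
  have hsum' : N < ∑ i, b' i := by
    by_contra! hcon
    obtain ⟨y, hy⟩ := SimplexGrid.exists_of_sum_eq (N := N)
      (fun i => b' i + (Pi.single i₁ (N - ∑ i, b' i) : ι → ℕ) i) (by
        rw [Finset.sum_add_distrib, Finset.sum_pi_single']
        simp only [Finset.mem_univ, if_true]; omega)
    obtain ⟨i, hi, hi'⟩ := hdom y
    have h1 := hi' _ (hkm i)
    rw [hy] at h1
    simp only [b', hi, if_false] at h1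
    omega
  have hbb' : ∑ i, b' i ≤ ∑ i, b i + Fintype.card ι := by
    have : ∑ i, b' i ≤ ∑ i, (b i + 1) := Finset.sum_le_sum fun i _ => by
      by_cases h : Sum.inr i ∈ σ <;> simp [b, b', h]
    simpa [Finset.sum_add_distrib] using this
  have hupper : ∀ k : SimplexGrid ι N, Sum.inl k ∈ σ → ∀ i,
      (k.1 i : ℕ) ≤ b i + Fintype.card ι := by
    intro k hk i
    have h1 : ∑ j ∈ Finset.univ.erase i, b j ≤ ∑ j ∈ Finset.univ.erase i, (k.1 j : ℕ) :=
      Finset.sum_le_sum fun j _ => hbk k hk j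
    have h2 := Finset.sum_erase_add Finset.univ (fun j => (k.1 j : ℕ)) (Finset.mem_univ i)
    have h3 := Finset.sum_erase_add Finset.univ b (Finset.mem_univ i)
    have h4 := k.2
    omega
  have hchoice : ∀ i, ∃ k : SimplexGrid ι N, Sum.inl k ∈ σ ∧
      (col k = i ∨ (k.1 i : ℕ) ≤ Fintype.card ι) := by
    intro i
    by_cases h : Sum.inr i ∈ σ
    -- Here `b i = 0`, so coordinate `i` is small at every grid point of `σ`.
    · refine ⟨k₀, hk₀, Or.inr ?_⟩
      simpa [b, h] using hupper k₀ hk₀ i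
    · obtain ⟨k, hk, hk'⟩ := hcol i h
      exact ⟨k, hk, Or.inl hk'⟩
  choose k hk hk' using hchoice
  exact ⟨k, fun i j l => (hupper _ (hk i) l).trans (Nat.add_le_add_right (hbk _ (hk j) l) _), hk'⟩

/-- A grid point is coloured by a coordinate that `f` does not decrease; one exists because the
coordinates sum to 1 before and after. Nearby points carrying the colours serve as `p i`, and a
missing colour means that the coordinate itself is small. -/
theorem exists_approx_fixedPoint_stdSimplex [Nonempty ι] {f : (ι → ℝ) → ι → ℝ}
    (hf : MapsTo f (stdSimplex ℝ ι) (stdSimplex ℝ ι)) {N : ℕ} (hN : 0 < N) :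
    ∃ p : ι → ι → ℝ, (∀ i, p i ∈ stdSimplex ℝ ι) ∧
      (∀ i j, dist (p i) (p j) ≤ Fintype.card ι / N) ∧
      ∀ i, p i i ≤ f (p i) i + Fintype.card ι / N := by
  have hN' : (0 : ℝ) < N := by exact_mod_cast hN
  let pt : SimplexGrid ι N → ι → ℝ := fun k i => ((k.1 i : ℕ) : ℝ) / N
  have hpt : ∀ k, pt k ∈ stdSimplex ℝ ι := SimplexGrid.div_mem_stdSimplex hN
  have hcol : ∀ k, ∃ i, pt k i ≤ f (pt k) i := by
    intro k
    obtain ⟨i, -, hi⟩ := Finset.exists_le_of_sum_le (s := Finset.univ) (f := pt k) (g := f (pt k))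
      Finset.univ_nonempty (by rw [(hpt k).2, (hf (hpt k)).2])
    exact ⟨i, hi⟩
  choose col hcol using hcol
  obtain ⟨k, hk, hk'⟩ := SimplexGrid.exists_nearby_colours col
  have hnear : ∀ i j l, pt (k i) l - pt (k j) l ≤ Fintype.card ι / N := by
    intro i j l
    have : (((k i).1 l : ℕ) : ℝ) ≤ ((k j).1 l : ℕ) + Fintype.card ι := by exact_mod_cast hk i j l
    simp only [pt]
    rw [← sub_div]
    gcongr
    linarith
  refine ⟨fun i => pt (k i), fun i => hpt _, fun i j => ?_, fun i => ?_⟩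
  · refine (dist_pi_le_iff (by positivity)).2 fun l => ?_
    rw [Real.dist_eq, abs_le]
    constructor <;> linarith [hnear i j l, hnear j i l]
  · rcases hk' i with h | h
    · have := hcol (k i)
      rw [h] at this
      have h0 : (0 : ℝ) ≤ Fintype.card ι / N := by positivity
      linarith
    · have h1 : pt (k i) i ≤ Fintype.card ι / N := by
        simp only [pt]
        gcongr
      have := (hf (hpt (k i))).1 i
      linarith

/-- **Brouwer's fixed point theorem** for the standard simplex. -/
theorem exists_fixedPoint_stdSimplex [Nonempty ι] {f : (ι → ℝ) → ι → ℝ}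
    (hf : MapsTo f (stdSimplex ℝ ι) (stdSimplex ℝ ι)) (hcont : ContinuousOn f (stdSimplex ℝ ι)) :
    ∃ x ∈ stdSimplex ℝ ι, f x = x := by
  have happ : ∀ n : ℕ, _ := fun n => exists_approx_fixedPoint_stdSimplex hf (Nat.succ_pos n)
  choose p hp hdist hle using happ
  have hzero : Tendsto (fun n : ℕ => (Fintype.card ι : ℝ) / (n.succ : ℕ)) atTop (𝓝 0) :=
    (tendsto_const_div_atTop_nhds_zero_nat _).comp (tendsto_add_atTop_nat 1)
  let i₀ : ι := Classical.arbitrary ι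
  obtain ⟨x, hx, φ, hφ, hlim⟩ := (isCompact_stdSimplex ℝ ι).tendsto_subseq (fun n => hp n i₀)
  have hzero' := hzero.comp hφ.tendsto_atTop
  have hlim' : ∀ i, Tendsto (fun n => p (φ n) i) atTop (𝓝 x) := by
    intro i
    refine (tendsto_iff_of_dist ?_).1 hlim
    exact squeeze_zero (fun _ => dist_nonneg) (fun n => hdist (φ n) i₀ i) hzero'
  -- All the `p i` merge in the limit, so one point satisfies every inequality; equal sums then
  -- force equality.
  have hge : ∀ i, x i ≤ f x i := by
    intro i
    have hxW : Tendsto (fun n => p (φ n) i) atTop (𝓝[stdSimplex ℝ ι] x) :=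
      tendsto_nhdsWithin_iff.2 ⟨hlim' i, Eventually.of_forall fun n => hp _ _⟩
    have h1 : Tendsto (fun n => f (p (φ n) i) i) atTop (𝓝 (f x i)) :=
      (tendsto_pi_nhds.1 ((hcont x hx).tendsto.comp hxW)) i
    have h2 := tendsto_pi_nhds.1 (hlim' i) i
    have h3 := h1.add hzero'
    rw [add_zero] at h3
    exact le_of_tendsto_of_tendsto' h2 h3 fun n => hle (φ n) i
  refine ⟨x, hx, ?_⟩
  have hsum : ∑ i, x i = ∑ i, f x i := by rw [hx.2, (hf hx).2]
  funext i
  exact ((Finset.sum_eq_sum_iff_of_le fun i _ => hge i).1 hsum i (Finset.mem_univ i)).symm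

end Brouwer

/-! ### Transfer to a box times a simplex -/

section BoxProd

variable {ι κ : Type*} [Fintype ι] [Fintype κ]

/-- The standard simplex is a retract of the nonnegative orthant. -/
theorem exists_retraction_stdSimplex [Nonempty κ] :
    ∃ r : (κ → ℝ) → κ → ℝ, Continuous r ∧ (∀ x, (∀ k, 0 ≤ x k) → r x ∈ stdSimplex ℝ κ) ∧
      ∀ x ∈ stdSimplex ℝ κ, r x = x := by
  have hpos : ∀ x : κ → ℝ, 0 < max 1 (∑ l, x l) := fun x => lt_max_of_lt_left one_pos
  have hκ : (0 : ℝ) < Fintype.card κ := by exact_mod_cast Fintype.card_pos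
  -- A deficit of mass is spread evenly, an excess is scaled away.
  refine ⟨fun x k => (x k + max 0 (1 - ∑ l, x l) / Fintype.card κ) / max 1 (∑ l, x l), ?_, ?_, ?_⟩
  · refine continuous_pi fun k => Continuous.div (by fun_prop) (by fun_prop) fun x => (hpos x).ne'
  · intro x hx
    refine ⟨fun k => ?_, ?_⟩
    · have := hx k
      have := hpos x
      positivity
    · rw [← Finset.sum_div, Finset.sum_add_distrib, Finset.sum_const, Finset.card_univ,
        nsmul_eq_mul, mul_div_cancel₀ _ hκ.ne', div_eq_one_iff_eq (hpos x).ne']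
      rcases le_total (∑ l, x l) 1 with h | h
      · rw [max_eq_right (by linarith), max_eq_left h]; ring
      · rw [max_eq_left (by linarith), max_eq_right h]; ring
  · rintro x ⟨-, hx⟩
    funext k
    simp [hx]

/-- Brouwer's fixed point theorem for the product of a box and a simplex. -/
theorem exists_fixedPoint_box_prod_stdSimplex [Nonempty κ] {R : ℝ} (hR : 0 < R)
    {F : (ι → ℝ) × (κ → ℝ) → (ι → ℝ) × (κ → ℝ)}
    (hF : MapsTo F ({u | ∀ i, |u i| ≤ R} ×ˢ stdSimplex ℝ κ) ({u | ∀ i, |u i| ≤ R} ×ˢ stdSimplex ℝ κ))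
    (hcont : ContinuousOn F ({u | ∀ i, |u i| ≤ R} ×ˢ stdSimplex ℝ κ)) :
    ∃ x ∈ ({u | ∀ i, |u i| ≤ R} ×ˢ stdSimplex ℝ κ : Set ((ι → ℝ) × (κ → ℝ))), F x = x := by
  classical
  obtain ⟨ρ, hρcont, hρmem, hρ⟩ := exists_retraction_stdSimplex (κ := κ)
  set K : Set ((ι → ℝ) × (κ → ℝ)) := {u | ∀ i, |u i| ≤ R} ×ˢ stdSimplex ℝ κ with hK
  set n : ℝ := (Fintype.card (ι ⊕ κ) : ℝ) with hn
  have hnpos : 0 < n := by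
    have : 0 < Fintype.card (ι ⊕ κ) := Fintype.card_pos
    rw [hn]; exact_mod_cast this
  -- `s` embeds the product in a larger simplex: coordinates are rescaled to `[0, 1]` and divided by
  -- their number `n`, and `none` receives the remaining mass. `r` is a left inverse of `s` on the
  -- product, so fixed points of `s ∘ F ∘ r` give fixed points of `F`.
  let r : (Option (ι ⊕ κ) → ℝ) → (ι → ℝ) × (κ → ℝ) := fun p =>
    (fun i => -R + 2 * R * min 1 (n * p (some (Sum.inl i))),
      ρ fun k => min 1 (n * p (some (Sum.inr k))))
  let w : (ι → ℝ) × (κ → ℝ) → ι ⊕ κ → ℝ := fun x =>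
    Sum.elim (fun i => (x.1 i + R) / (2 * R)) x.2
  let s : (ι → ℝ) × (κ → ℝ) → Option (ι ⊕ κ) → ℝ := fun x e =>
    e.elim (1 - ∑ e, w x e / n) (fun e => w x e / n)
  have hrcont : Continuous r := by
    refine Continuous.prodMk (by fun_prop) (hρcont.comp (by fun_prop))
  have hscont : Continuous s := by
    have hw : ∀ e, Continuous fun x => w x e := by
      rintro (i | k)
      · exact (((continuous_apply i).comp continuous_fst).add continuous_const).div_const _
      · exact (continuous_apply k).comp continuous_snd
    refine continuous_pi fun e => ?_
    rcases e with _ | e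
    · exact continuous_const.sub (continuous_finsetSum _ fun e _ => (hw e).div_const _)
    · exact (hw e).div_const _
  have hrmem : MapsTo r (stdSimplex ℝ _) K := by
    intro p hp
    have h01 : ∀ e, 0 ≤ min 1 (n * p e) := fun e =>
      le_min zero_le_one (mul_nonneg hnpos.le (hp.1 e))
    refine ⟨fun i => abs_le.2 ?_, hρmem _ fun k => h01 _⟩
    have h0 := h01 (some (Sum.inl i))
    have h1 := min_le_left 1 (n * p (some (Sum.inl i)))
    constructor <;> simp only [r] <;> nlinarith
  have hw01 : ∀ x ∈ K, ∀ e, 0 ≤ w x e ∧ w x e ≤ 1 := by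
    rintro x ⟨hx1, hx2⟩ (i | k)
    · have := abs_le.1 (hx1 i)
      refine ⟨div_nonneg (by linarith) (by linarith), (div_le_one (by linarith)).2 (by linarith)⟩
    · exact ⟨hx2.1 k, hx2.2 ▸ Finset.single_le_sum (fun l _ => hx2.1 l) (Finset.mem_univ k)⟩
  have hsmem : MapsTo s K (stdSimplex ℝ _) := by
    intro x hx
    refine ⟨fun e => ?_, ?_⟩
    · rcases e with _ | e
      · have : ∑ e, w x e / n ≤ ∑ _e : ι ⊕ κ, 1 / n :=
          Finset.sum_le_sum fun e _ => by
            have := (hw01 x hx e).2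
            gcongr
        rw [Finset.sum_const, Finset.card_univ, nsmul_eq_mul, ← hn, mul_one_div_cancel hnpos.ne']
          at this
        simpa [s] using this
      · exact div_nonneg (hw01 x hx e).1 hnpos.le
    · rw [Fintype.sum_option]
      simp [s]
  have hrs : ∀ x ∈ K, r (s x) = x := by
    intro x hx
    have hmin : ∀ e, min 1 (n * s x (some e)) = w x e := by
      intro e
      have : n * s x (some e) = w x e := mul_div_cancel₀ _ hnpos.ne'
      rw [this, min_eq_right (hw01 x hx e).2]
    refine Prod.ext (funext fun i => ?_) ?_
    · simp only [r, hmin, w, Sum.elim_inl]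
      field_simp
      ring
    · simp only [r, hmin, w, Sum.elim_inr]
      exact hρ _ hx.2
  obtain ⟨p, hp, hfix⟩ := exists_fixedPoint_stdSimplex (f := s ∘ F ∘ r)
    (hsmem.comp (hF.comp hrmem))
    (hscont.comp_continuousOn (hcont.comp hrcont.continuousOn hrmem))
  refine ⟨r p, hrmem hp, ?_⟩
  have := congrArg r hfix
  rwa [Function.comp_apply, Function.comp_apply, hrs _ (hF (hrmem hp))] at this

end BoxProd

/-! ### Existence, stability and continuity of the minimizers -/

namespace MeanFieldGame

variable {d : ℕ} {c : Fin d → (Fin d → ℝ) → (Fin d → ℝ) → ℝ}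

@[simp]
theorem diffOp_self (i : Fin d) (z : Fin d → ℝ) : diffOp i z i = 0 := sub_self _

@[simp]
theorem diffOp_diffOp (i : Fin d) (z : Fin d → ℝ) : diffOp i (diffOp i z) = diffOp i z := by
  funext j
  simp [diffOp]

@[simp]
theorem h_diffOp (z θ : Fin d → ℝ) (i : Fin d) : h c (diffOp i z) θ i = h c z θ i := by
  have : hamiltonianCost c (diffOp i z) θ i = hamiltonianCost c z θ i := by
    funext μ
    simp [hamiltonianCost]
  rw [h, h, this]

theorem zero_mem_orthant : (0 : Fin d → ℝ) ∈ orthant d := fun _ => le_rfl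

theorem update_zero_mem_orthant {α : Fin d → ℝ} (hα : α ∈ orthant d) (i : Fin d) :
    Function.update α i 0 ∈ orthant d := by
  intro j
  by_cases hj : j = i
  · subst hj; simp
  · rw [Function.update_of_ne hj]; exact hα j

/-- Neither the running cost nor the linear term, where `diffOp i z i = 0`, sees coordinate `i`. The
chosen minimizer is arbitrary there, so this coordinate is set to 0 in compactness and continuity
arguments. -/
theorem IsRunningCost.hamiltonianCost_update (hc : IsRunningCost c) {θ : Fin d → ℝ}
    (hθ : θ ∈ stdSimplex ℝ (Fin d)) (z : Fin d → ℝ) (i : Fin d) {α : Fin d → ℝ}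
    (hα : α ∈ orthant d) :
    hamiltonianCost c z θ i (Function.update α i 0) = hamiltonianCost c z θ i α := by
  unfold hamiltonianCost
  congr 1
  · exact hc.indep i θ hθ _ (update_zero_mem_orthant hα i) _ hα
      fun j hj => Function.update_of_ne hj _ _
  · refine Finset.sum_congr rfl fun j _ => ?_
    by_cases hj : j = i
    · subst hj; simp
    · rw [Function.update_of_ne hj]

theorem IsRunningCost.continuousOn (hc : IsRunningCost c) (i : Fin d) :
    ContinuousOn (fun p : (Fin d → ℝ) × (Fin d → ℝ) => c i p.1 p.2)
      (stdSimplex ℝ (Fin d) ×ˢ orthant d) := by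
  obtain ⟨K, hK⟩ := hc.lipschitz
  refine continuousOn_prod_of_continuousOn_lipschitzOnWith _ (Real.toNNReal K)
    (fun θ hθ => (hc.differentiable i θ hθ).continuousOn) fun α hα =>
    LipschitzOnWith.of_dist_le_mul fun θ hθ θ' hθ' => ?_
  rw [Real.dist_eq, dist_eq_norm]
  exact (hK i θ hθ θ' hθ' α hα).trans
    (mul_le_mul_of_nonneg_right (Real.le_coe_toNNReal K) (norm_nonneg _))

/-- Quadratic growth of the Hamiltonian cost away from a minimizer. -/
theorem IsRunningCost.exists_quadratic_growth (hc : IsRunningCost c) :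
    ∃ γ : ℝ, 0 < γ ∧ ∀ i, ∀ θ ∈ stdSimplex ℝ (Fin d), ∀ z, ∀ α ∈ orthant d, ∀ α' ∈ orthant d,
      IsMinOn (hamiltonianCost c z θ i) (orthant d) α →
      hamiltonianCost c z θ i α + γ * ∑ j ∈ Finset.univ.erase i, (α' j - α j) ^ 2
        ≤ hamiltonianCost c z θ i α' := by
  obtain ⟨γ, hγ, hconv⟩ := hc.uniform_convex
  refine ⟨γ / 2, by positivity, fun i θ hθ z α hα α' hα' hmin => ?_⟩
  -- Convexity at the midpoint towards both ends makes the derivative terms cancel, so no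
  -- first-order condition at a boundary minimizer is needed. Each half contributes `γ / 4`, whence
  -- `γ / 2`.
  let m : Fin d → ℝ := fun j => (α j + α' j) / 2
  have hm : m ∈ orthant d := fun j => by
    have := hα j
    have := hα' j
    simp only [m]
    positivity
  have h1 := hconv i θ hθ m hm α hα
  have h2 := hconv i θ hθ m hm α' hα'
  have hneg : α' - m = -(α - m) := by
    funext j
    simp only [m, Pi.sub_apply, Pi.neg_apply]
    ring
  rw [hneg, map_neg] at h2
  have hs1 : ∑ j ∈ Finset.univ.erase i, (α j - m j) ^ 2
      = (1 / 4) * ∑ j ∈ Finset.univ.erase i, (α' j - α j) ^ 2 := by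
    rw [Finset.mul_sum]
    refine Finset.sum_congr rfl fun j _ => ?_
    simp only [m]
    ring
  have hs2 : ∑ j ∈ Finset.univ.erase i, (α' j - m j) ^ 2
      = (1 / 4) * ∑ j ∈ Finset.univ.erase i, (α' j - α j) ^ 2 := by
    rw [Finset.mul_sum]
    refine Finset.sum_congr rfl fun j _ => ?_
    simp only [m]
    ring
  have hlin : ∑ j, m j * diffOp i z j
      = (∑ j, α j * diffOp i z j + ∑ j, α' j * diffOp i z j) / 2 := by
    rw [← Finset.sum_add_distrib, Finset.sum_div]
    refine Finset.sum_congr rfl fun j _ => ?_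
    simp only [m]
    ring
  have h3 : hamiltonianCost c z θ i α ≤ hamiltonianCost c z θ i m := hmin hm
  rw [hs1] at h1
  rw [hs2] at h2
  unfold hamiltonianCost at h3 ⊢
  rw [hlin] at h3
  linarith

/-- With coordinate `i` set to 0, the quadratic term of uniform convexity at the origin beats all
linear terms outside the ball of radius `B / γ`; inside it, compactness applies. -/
theorem IsRunningCost.exists_isMinOn (hc : IsRunningCost c) {θ : Fin d → ℝ}
    (hθ : θ ∈ stdSimplex ℝ (Fin d)) (z : Fin d → ℝ) (i : Fin d) :
    ∃ μ ∈ orthant d, IsMinOn (hamiltonianCost c z θ i) (orthant d) μ := by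
  obtain ⟨γ, hγ, hconv⟩ := hc.uniform_convex
  let D := fderivWithin ℝ (c i θ) (orthant d) 0
  let B : ℝ := ‖D‖ + ∑ j, |diffOp i z j|
  have hB : 0 ≤ B := by positivity
  have hgrowth : ∀ α ∈ orthant d, α i = 0 → B / γ ≤ ‖α‖ →
      hamiltonianCost c z θ i 0 ≤ hamiltonianCost c z θ i α := by
    intro α hα hαi hnorm
    have h1 := hconv i θ hθ 0 zero_mem_orthant α hα
    have h2 : -(‖D‖ * ‖α‖) ≤ D α := (abs_le.1 (D.le_opNorm α)).1
    have h3 : -((∑ j, |diffOp i z j|) * ‖α‖) ≤ ∑ j, α j * diffOp i z j := by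
      rw [Finset.sum_mul, ← Finset.sum_neg_distrib]
      refine Finset.sum_le_sum fun j _ => ?_
      have := (abs_le.1 (abs_mul (α j) (diffOp i z j)).le).1
      have h4 : |α j| ≤ ‖α‖ := norm_le_pi_norm α j
      nlinarith [abs_nonneg (diffOp i z j)]
    have h4 : ‖α‖ ^ 2 ≤ ∑ j ∈ Finset.univ.erase i, (α j - (0 : Fin d → ℝ) j) ^ 2 := by
      have hnn : 0 ≤ ∑ j ∈ Finset.univ.erase i, (α j - (0 : Fin d → ℝ) j) ^ 2 :=
        Finset.sum_nonneg fun j _ => sq_nonneg _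
      rw [← Real.le_sqrt (norm_nonneg _) hnn, pi_norm_le_iff_of_nonneg (Real.sqrt_nonneg _)]
      intro j
      by_cases hj : j = i
      · rw [hj, hαi, norm_zero]; exact Real.sqrt_nonneg _
      · refine Real.abs_le_sqrt ?_
        have := Finset.single_le_sum (f := fun j => (α j - (0 : Fin d → ℝ) j) ^ 2)
          (fun j _ => sq_nonneg _) (Finset.mem_erase.2 ⟨hj, Finset.mem_univ j⟩)
        simpa using this
    rw [sub_zero] at h1
    have h5 : B ≤ γ * ‖α‖ := by rwa [div_le_iff₀' hγ] at hnorm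
    have h6 : B * ‖α‖ ≤ γ * ‖α‖ ^ 2 := by nlinarith [norm_nonneg α]
    have h7 : γ * ‖α‖ ^ 2 ≤ γ * ∑ j ∈ Finset.univ.erase i, (α j - (0 : Fin d → ℝ) j) ^ 2 :=
      mul_le_mul_of_nonneg_left h4 hγ.le
    have h8 : B * ‖α‖ = ‖D‖ * ‖α‖ + (∑ j, |diffOp i z j|) * ‖α‖ := add_mul _ _ _
    have h9 : ∑ j, (0 : Fin d → ℝ) j * diffOp i z j = 0 := by simp
    unfold hamiltonianCost
    rw [h9]
    change D α + _ ≤ _ at h1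
    linarith
  have hclosed : IsClosed {α : Fin d → ℝ | α ∈ orthant d ∧ α i = 0} := by
    refine IsClosed.inter ?_ (isClosed_eq (continuous_apply i) continuous_const)
    have : orthant d = ⋂ j, {α : Fin d → ℝ | 0 ≤ α j} := by ext; simp [orthant]
    change IsClosed (orthant d)
    rw [this]
    exact isClosed_iInter fun j => isClosed_le continuous_const (continuous_apply j)
  let S : Set (Fin d → ℝ) := Metric.closedBall 0 (B / γ) ∩ {α | α ∈ orthant d ∧ α i = 0}
  have hS : IsCompact S := (isCompact_closedBall _ _).inter_right hclosed
  have h0S : (0 : Fin d → ℝ) ∈ S :=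
    ⟨Metric.mem_closedBall_self (by positivity), zero_mem_orthant, rfl⟩
  have hcont : ContinuousOn (hamiltonianCost c z θ i) S := by
    refine ContinuousOn.add ((hc.differentiable i θ hθ).continuousOn.mono fun α hα => hα.2.1) ?_
    exact Continuous.continuousOn (by fun_prop)
  obtain ⟨μ, hμ, hmin⟩ := hS.exists_isMinOn ⟨0, h0S⟩ hcont
  refine ⟨μ, hμ.2.1, fun α hα => ?_⟩
  rw [mem_ofPred_eq, ← hc.hamiltonianCost_update hθ z i hα]
  have hα' := update_zero_mem_orthant hα i
  by_cases hn : ‖Function.update α i 0‖ ≤ B / γ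
  · exact hmin ⟨mem_closedBall_zero_iff.2 hn, hα', by simp⟩
  · exact (hmin h0S).trans (hgrowth _ hα' (by simp) (not_le.1 hn).le)

theorem IsRunningCost.argminRate_spec (hc : IsRunningCost c) {θ : Fin d → ℝ}
    (hθ : θ ∈ stdSimplex ℝ (Fin d)) (z : Fin d → ℝ) (i : Fin d) :
    argminRate c z θ i ∈ orthant d ∧
      IsMinOn (hamiltonianCost c z θ i) (orthant d) (argminRate c z θ i) := by
  have H := hc.exists_isMinOn hθ z i
  rw [argminRate, dif_pos H]
  exact H.choose_spec

theorem IsRunningCost.h_eq (hc : IsRunningCost c) {θ : Fin d → ℝ}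
    (hθ : θ ∈ stdSimplex ℝ (Fin d)) (z : Fin d → ℝ) (i : Fin d) :
    h c z θ i = hamiltonianCost c z θ i (Function.update (argminRate c z θ i) i 0) := by
  obtain ⟨hmem, hmin⟩ := hc.argminRate_spec hθ z i
  rw [hc.hamiltonianCost_update hθ z i hmem]
  refine IsLeast.csInf_eq ⟨mem_image_of_mem _ hmem, ?_⟩
  rintro _ ⟨α, hα, rfl⟩
  exact hmin hα

theorem continuous_diffOp (i : Fin d) : Continuous (diffOp i) := by
  unfold diffOp
  fun_prop

/-- Stability of the minimizers in `z` and `θ`. -/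
theorem IsRunningCost.exists_sq_argminRate_sub_le (hc : IsRunningCost c) :
    ∃ A B : ℝ, ∀ i j, j ≠ i → ∀ θ ∈ stdSimplex ℝ (Fin d), ∀ θ' ∈ stdSimplex ℝ (Fin d), ∀ z z',
      (argminRate c z' θ' i j - argminRate c z θ i j) ^ 2
        ≤ A * ‖θ - θ'‖ + B * ∑ k, (diffOp i z k - diffOp i z' k) ^ 2 := by
  obtain ⟨K, hK⟩ := hc.lipschitz
  obtain ⟨γ, hγ, hgrowth⟩ := hc.exists_quadratic_growth
  refine ⟨2 * K / γ, 1 / (γ ^ 2), fun i j hj θ hθ θ' hθ' z z' => ?_⟩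
  obtain ⟨hμ, hmin⟩ := hc.argminRate_spec hθ z i
  obtain ⟨hμ', hmin'⟩ := hc.argminRate_spec hθ' z' i
  set μ := argminRate c z θ i
  set μ' := argminRate c z' θ' i
  set S := ∑ j ∈ Finset.univ.erase i, (μ' j - μ j) ^ 2 with hS
  have hsymm : ∑ j ∈ Finset.univ.erase i, (μ j - μ' j) ^ 2 = S :=
    Finset.sum_congr rfl fun j _ => by ring
  have h1 := hgrowth i θ hθ z μ hμ μ' hμ' hmin
  have h2 := hgrowth i θ' hθ' z' μ' hμ' μ hμ hmin'
  rw [hsymm] at h2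
  have h3 := (abs_le.1 (hK i θ hθ θ' hθ' μ' hμ')).2
  have h4 := (abs_le.1 (hK i θ hθ θ' hθ' μ hμ)).1
  -- The two growth inequalities add up to a term `2 * γ * S`; Young's inequality for the cross term
  -- uses up only half of it.
  have h5 : ∑ j, μ' j * diffOp i z j - ∑ j, μ j * diffOp i z j
      + (∑ j, μ j * diffOp i z' j - ∑ j, μ' j * diffOp i z' j)
      ≤ γ * S + 1 / γ * ∑ k, (diffOp i z k - diffOp i z' k) ^ 2 := by
    have e : ∑ j, μ' j * diffOp i z j - ∑ j, μ j * diffOp i z j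
      + (∑ j, μ j * diffOp i z' j - ∑ j, μ' j * diffOp i z' j)
      = ∑ j ∈ Finset.univ.erase i, (μ' j - μ j) * (diffOp i z j - diffOp i z' j) := by
      rw [← Finset.sum_sub_distrib, ← Finset.sum_sub_distrib, ← Finset.sum_add_distrib,
        ← Finset.sum_erase_add _ _ (Finset.mem_univ i)]
      simp only [diffOp_self, mul_zero, sub_zero, add_zero]
      exact Finset.sum_congr rfl fun j _ => by ring
    have e' : ∑ k, (diffOp i z k - diffOp i z' k) ^ 2
        = ∑ k ∈ Finset.univ.erase i, (diffOp i z k - diffOp i z' k) ^ 2 := by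
      rw [← Finset.sum_erase_add _ _ (Finset.mem_univ i)]
      simp
    rw [e, e', hS, Finset.mul_sum, Finset.mul_sum, ← Finset.sum_add_distrib]
    refine Finset.sum_le_sum fun k _ => ?_
    have : 0 ≤ 1 / γ * (γ * (μ' k - μ k) - (diffOp i z k - diffOp i z' k) / 2) ^ 2 := by positivity
    have e2 : 1 / γ * (γ * (μ' k - μ k) - (diffOp i z k - diffOp i z' k) / 2) ^ 2
        = γ * (μ' k - μ k) ^ 2 - (μ' k - μ k) * (diffOp i z k - diffOp i z' k)
          + 1 / γ * (diffOp i z k - diffOp i z' k) ^ 2 / 4 := by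
      field_simp
      ring
    have : 0 ≤ 1 / γ * (diffOp i z k - diffOp i z' k) ^ 2 := by positivity
    linarith
  unfold hamiltonianCost at h1 h2
  have h6 : γ * S ≤ 2 * K * ‖θ - θ'‖ + 1 / γ * ∑ k, (diffOp i z k - diffOp i z' k) ^ 2 := by
    linarith
  have h7 : (μ' j - μ j) ^ 2 ≤ S :=
    Finset.single_le_sum (f := fun j => (μ' j - μ j) ^ 2) (fun j _ => sq_nonneg _)
      (Finset.mem_erase.2 ⟨hj, Finset.mem_univ j⟩)
  refine h7.trans ?_
  rw [← mul_le_mul_iff_right₀ hγ]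
  refine h6.trans_eq ?_
  field_simp

theorem IsRunningCost.continuousOn_argminRate (hc : IsRunningCost c) {i j : Fin d} (hj : j ≠ i) :
    ContinuousOn (fun p : (Fin d → ℝ) × (Fin d → ℝ) => argminRate c p.1 p.2 i j)
      (univ ×ˢ stdSimplex ℝ (Fin d)) := by
  obtain ⟨A, B, hAB⟩ := hc.exists_sq_argminRate_sub_le
  rintro ⟨z, θ⟩ ⟨-, hθ⟩
  let b : (Fin d → ℝ) × (Fin d → ℝ) → ℝ := fun p =>
    √(A * ‖θ - p.2‖ + B * ∑ k, (diffOp i z k - diffOp i p.1 k) ^ 2)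
  have hb : Tendsto b (𝓝[univ ×ˢ stdSimplex ℝ (Fin d)] (z, θ)) (𝓝 0) := by
    have hbc : Continuous b := by
      have := fun k => (continuous_apply k).comp ((continuous_diffOp i).comp
        (continuous_fst (X := Fin d → ℝ) (Y := Fin d → ℝ)))
      simp only [Function.comp_def] at this
      fun_prop
    have hb0 : b (z, θ) = 0 := by simp [b]
    rw [← hb0]
    exact hbc.continuousWithinAt
  refine tendsto_iff_dist_tendsto_zero.2 (squeeze_zero' (Eventually.of_forall fun _ => dist_nonneg)
    ?_ hb)
  filter_upwards [self_mem_nhdsWithin] with p hp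
  rw [Real.dist_eq]
  exact Real.abs_le_sqrt (hAB i j hj θ hθ p.2 hp.2 z p.1)

theorem IsRunningCost.continuousOn_h (hc : IsRunningCost c) (i : Fin d) :
    ContinuousOn (fun p : (Fin d → ℝ) × (Fin d → ℝ) => h c p.1 p.2 i)
      (univ ×ˢ stdSimplex ℝ (Fin d)) := by
  let a : (Fin d → ℝ) × (Fin d → ℝ) → Fin d → ℝ := fun p =>
    Function.update (argminRate c p.1 p.2 i) i 0
  have ha : ContinuousOn a (univ ×ˢ stdSimplex ℝ (Fin d)) := by
    refine continuousOn_pi.2 fun j => ?_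
    by_cases hj : j = i
    · subst hj
      simp only [a, Function.update_self]
      exact continuousOn_const
    · simp only [a, Function.update_of_ne hj]
      exact hc.continuousOn_argminRate hj
  have hcomp : ContinuousOn (fun p => c i p.2 (a p)) (univ ×ˢ stdSimplex ℝ (Fin d)) :=
    (hc.continuousOn i).comp (continuousOn_snd.prodMk ha) fun p hp =>
      ⟨hp.2, update_zero_mem_orthant (hc.argminRate_spec hp.2 p.1 i).1 i⟩
  refine ContinuousOn.congr (f := fun p => c i p.2 (a p) + ∑ j, a p j * diffOp i p.1 j)
    (hcomp.add (continuousOn_finsetSum _ fun j _ => (continuousOn_pi.1 ha j).mul ?_))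
    fun p hp => hc.h_eq hp.2 p.1 i
  exact ((continuous_apply j).comp ((continuous_diffOp i).comp continuous_fst)).continuousOn

theorem IsRunningCost.continuousOn_αStar (hc : IsRunningCost c) (i j : Fin d) :
    ContinuousOn (fun p : (Fin d → ℝ) × (Fin d → ℝ) => αStar c p.1 p.2 i j)
      (univ ×ˢ stdSimplex ℝ (Fin d)) := by
  unfold αStar
  by_cases hj : j = i
  · simp only [hj, if_true]
    exact (continuousOn_finsetSum _ fun k hk =>
      hc.continuousOn_argminRate (Finset.ne_of_mem_erase hk)).neg
  · simp only [hj, if_false]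
    exact hc.continuousOn_argminRate hj

theorem sum_αStar (z θ : Fin d → ℝ) (i : Fin d) : ∑ j, αStar c z θ i j = 0 := by
  rw [← Finset.sum_erase_add _ _ (Finset.mem_univ i)]
  have : ∑ j ∈ Finset.univ.erase i, αStar c z θ i j
      = ∑ j ∈ Finset.univ.erase i, argminRate c z θ i j :=
    Finset.sum_congr rfl fun j hj => if_neg (Finset.ne_of_mem_erase hj)
  rw [this, αStar, if_pos rfl, add_neg_cancel]

theorem IsRunningCost.αStar_nonneg (hc : IsRunningCost c) {θ : Fin d → ℝ}
    (hθ : θ ∈ stdSimplex ℝ (Fin d)) (z : Fin d → ℝ) {i j : Fin d} (hj : j ≠ i) :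
    0 ≤ αStar c z θ i j := by
  rw [αStar, if_neg hj]
  exact (hc.argminRate_spec hθ z i).1 j

/-! ### Oscillation and backward invariance -/

theorem sub_div_two_le_sharpNorm (u : Fin d → ℝ) (i j : Fin d) :
    (u i - u j) / 2 ≤ sharpNorm u := by
  refine le_ciInf fun l => ?_
  have h1 := (abs_le.1 (norm_le_pi_norm (u + fun _ => l) i)).2
  have h2 := (abs_le.1 (norm_le_pi_norm (u + fun _ => l) j)).1
  simp only [Pi.add_apply] at h1 h2
  linarith

theorem sharpNorm_eq {u : Fin d → ℝ} {i j : Fin d} (hi : ∀ k, u k ≤ u i) (hj : ∀ k, u j ≤ u k) :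
    sharpNorm u = (u i - u j) / 2 := by
  refine le_antisymm ?_ (sub_div_two_le_sharpNorm u i j)
  have hbdd : BddBelow (range fun l : ℝ => ‖u + fun _ => l‖) :=
    ⟨0, by rintro _ ⟨l, rfl⟩; exact norm_nonneg _⟩
  -- The optimal shift centres the range of `u` at 0.
  refine (ciInf_le hbdd (-(u i + u j) / 2)).trans ?_
  refine (pi_norm_le_iff_of_nonneg (by linarith [hi j])).2 fun k => abs_le.2 ?_
  simp only [Pi.add_apply]
  constructor <;> linarith [hi k, hj k]

theorem le_sharpNorm_iff [Nonempty (Fin d)] {u : Fin d → ℝ} {M : ℝ} :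
    M ≤ sharpNorm u ↔ ∃ i j, 2 * M ≤ u i - u j := by
  constructor
  · intro h
    obtain ⟨i, hi⟩ := Finite.exists_max u
    obtain ⟨j, hj⟩ := Finite.exists_min u
    rw [sharpNorm_eq hi hj] at h
    exact ⟨i, j, by linarith⟩
  · rintro ⟨i, j, h⟩
    linarith [sub_div_two_le_sharpNorm u i j]

/-- Along solutions of the Hamilton–Jacobi equation, the oscillation of `u` cannot drop to values
below a large level. -/
theorem IsContractive.exists_isBackwardInvariant [Nonempty (Fin d)] (hh : IsContractive c) :
    ∃ M₀ : ℝ, ∀ M : ℝ, M₀ ≤ M →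
      IsBackwardInvariant c ({u : Fin d → ℝ | sharpNorm u < M} ×ˢ stdSimplex ℝ (Fin d)) := by
  obtain ⟨M₁, -, hM₁⟩ := hh
  -- Contractivity needs the norm strictly above `M₁`, whereas at the critical time it is only known
  -- to be at least `M`.
  refine ⟨M₁ + 1, fun M hM a b θ u _ hsol hb t ht => ⟨?_, hsol.mem_simplex t ht⟩⟩
  by_contra hcon
  have hcon : M ≤ sharpNorm (u t) := not_lt.1 hcon
  have hb : sharpNorm (u b) < M := hb.1
  have hcont : ∀ i, ContinuousOn (fun s => u s i) (Icc a b) := fun i s hs =>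
    (hsol.hamiltonJacobi s hs i).continuousWithinAt
  let T : Set ℝ := {s ∈ Icc t b | M ≤ sharpNorm (u s)}
  have hT : IsCompact T := by
    have hsub : Icc t b ⊆ Icc a b := Icc_subset_Icc_left ht.1
    have : T = ⋃ i, ⋃ j, {s ∈ Icc t b | 2 * M ≤ u s i - u s j} := by
      ext s
      simp only [T, le_sharpNorm_iff, mem_iUnion]
      exact ⟨fun ⟨hs, i, j, h⟩ => ⟨i, j, hs, h⟩, fun ⟨i, j, hs, h⟩ => ⟨hs, i, j, h⟩⟩
    rw [this]
    refine isCompact_iUnion fun i => isCompact_iUnion fun j => ?_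
    refine isCompact_Icc.of_isClosed_subset ?_ fun s hs => hs.1
    exact (((hcont i).sub (hcont j)).mono hsub).preimage_isClosed_of_isClosed isClosed_Icc
      isClosed_Ici
  -- `s` is the last time at which the norm is at least `M`.
  obtain ⟨s, ⟨hs, hsM⟩, hsmax⟩ := hT.exists_isGreatest ⟨t, left_mem_Icc.2 ht.2, hcon⟩
  have hsb : s < b := lt_of_le_of_ne hs.2 fun h => by
    rw [h] at hsM; exact absurd hb (not_lt.2 hsM)
  have hsab : s ∈ Icc a b := ⟨ht.1.trans hs.1, hs.2⟩
  obtain ⟨i, hi⟩ := Finite.exists_max (u s)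
  obtain ⟨j, hj⟩ := Finite.exists_min (u s)
  have hMs : M₁ < sharpNorm (u s) := by linarith
  have hθ := hsol.mem_simplex s hsab
  have h1 := (hM₁ (θ s) hθ i (u s) hMs).1 fun k => sub_nonpos.2 (hi k)
  have h2 := (hM₁ (θ s) hθ j (u s) hMs).2 fun k => sub_nonneg.2 (hj k)
  have hderiv := ((hsol.hamiltonJacobi s hsab i).sub (hsol.hamiltonJacobi s hsab j)).mono
    (Icc_subset_Icc_left hsab.1 : Icc s b ⊆ Icc a b)
  have hslope := hasDerivWithinAt_iff_tendsto_slope.1 hderiv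
  have hIoc : Icc s b \ {s} = Ioc s b := by
    rw [Icc_sdiff_left]
  rw [hIoc] at hslope
  have hne : (𝓝[Ioc s b] s).NeBot := by
    rw [nhdsWithin_Ioc_eq_nhdsGT hsb]; infer_instance
  -- After `s` the gap `u i - u j` stays below its value at `s`, so its right derivative is
  -- nonpositive; `h1` and `h2` make it positive.
  have hle := le_of_tendsto hslope (b := 0) (by
    filter_upwards [self_mem_nhdsWithin] with r hr
    rw [slope_def_field]
    refine div_nonpos_of_nonpos_of_nonneg ?_ (sub_nonneg.2 hr.1.le)
    have hr' : sharpNorm (u r) < M := by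
      by_contra hcon'
      exact absurd (hsmax ⟨⟨hs.1.trans hr.1.le, hr.2⟩, not_lt.1 hcon'⟩) (not_le.2 hr.1)
    have h3 := sub_div_two_le_sharpNorm (u r) i j
    rw [sharpNorm_eq hi hj] at hsM
    simp only [Pi.sub_apply]
    linarith)
  linarith

/-! ### Stationary solutions -/

/-- If the mass inflow is proportional to the mass through its positive part, it vanishes. -/
theorem eq_zero_of_posPart_eq_mul {ι : Type*} [Fintype ι] {θ G : ι → ℝ} (hG : ∑ i, G i = 0)
    (hG0 : ∀ i, θ i = 0 → 0 ≤ G i) (hθ : ∀ i, 0 ≤ θ i)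
    (h : ∀ i, max 0 (G i) = (∑ k, max 0 (G k)) * θ i) (i : ι) : G i = 0 := by
  have hs : 0 ≤ ∑ k, max 0 (G k) := Finset.sum_nonneg fun k _ => le_max_left _ _
  rcases hs.eq_or_lt with hs | hs
  · have hle : ∀ k ∈ Finset.univ, G k ≤ 0 := fun k hk =>
      (le_max_right 0 (G k)).trans_eq
        ((Finset.sum_eq_zero_iff_of_nonneg fun k _ => le_max_left 0 (G k)).1 hs.symm k hk)
    exact (Finset.sum_eq_zero_iff_of_nonpos hle).1 hG i (Finset.mem_univ i)
  · have hge : ∀ k ∈ Finset.univ, 0 ≤ G k := by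
      intro k _
      rcases (hθ k).eq_or_lt with hk | hk
      · exact hG0 k hk.symm
      · by_contra! hneg
        have := h k
        rw [max_eq_left hneg.le] at this
        exact (mul_pos hs hk).ne this
    exact (Finset.sum_eq_zero_iff_of_nonneg hge).1 hG i (Finset.mem_univ i)

/-- A pair of continuous vector fields on the product of a box and a simplex has a point at which
the first one vanishes up to the constraints of the box, and the positive part of the second one is
proportional to the point of the simplex. -/
theorem exists_equilibrium_box_prod_stdSimplex {ι κ : Type*} [Fintype ι] [Fintype κ] [Nonempty κ]
    {R : ℝ} (hR : 0 < R) {v : (ι → ℝ) × (κ → ℝ) → ι → ℝ} {G : (ι → ℝ) × (κ → ℝ) → κ → ℝ}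
    (hv : ∀ i, ContinuousOn (fun p => v p i) (univ ×ˢ stdSimplex ℝ κ))
    (hG : ∀ i, ContinuousOn (fun p => G p i) (univ ×ˢ stdSimplex ℝ κ)) :
    ∃ u : ι → ℝ, ∃ θ ∈ stdSimplex ℝ κ, (∀ i, |u i| ≤ R) ∧ (∀ i, 0 < v (u, θ) i → u i = R) ∧
      (∀ i, v (u, θ) i < 0 → u i = -R) ∧
      ∀ i, max 0 (G (u, θ) i) = (∑ k, max 0 (G (u, θ) k)) * θ i := by
  have hS : ∀ p, 0 < 1 + ∑ k, max 0 (G p k) := fun p =>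
    add_pos_of_pos_of_nonneg one_pos (Finset.sum_nonneg fun k _ => le_max_left _ _)
  let F : (ι → ℝ) × (κ → ℝ) → (ι → ℝ) × (κ → ℝ) := fun p =>
    (fun i => max (-R) (min R (p.1 i + v p i)),
      fun i => (p.2 i + max 0 (G p i)) / (1 + ∑ k, max 0 (G p k)))
  have hmaps : MapsTo F ({u | ∀ i, |u i| ≤ R} ×ˢ stdSimplex ℝ κ)
      ({u | ∀ i, |u i| ≤ R} ×ˢ stdSimplex ℝ κ) := by
    rintro p ⟨-, hp⟩
    refine ⟨fun i => abs_le.2 ⟨le_max_left _ _, max_le (by linarith) (min_le_left _ _)⟩,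
      fun i => ?_, ?_⟩
    · exact div_nonneg (add_nonneg (hp.1 i) (le_max_left _ _)) (hS p).le
    · simp only [F]
      rw [← Finset.sum_div, Finset.sum_add_distrib, hp.2, div_self (hS p).ne']
  have hcont : ContinuousOn F (univ ×ˢ stdSimplex ℝ κ) := by
    refine ContinuousOn.prodMk (continuousOn_pi.2 fun i => ?_) (continuousOn_pi.2 fun i => ?_)
    · exact continuousOn_const.sup (continuousOn_const.inf (ContinuousOn.add (by fun_prop) (hv i)))
    · exact ContinuousOn.div (ContinuousOn.add (by fun_prop) (continuousOn_const.sup (hG i)))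
        (continuousOn_const.add (continuousOn_finsetSum _ fun k _ => continuousOn_const.sup (hG k)))
        fun p _ => (hS p).ne'
  obtain ⟨⟨u, θ⟩, ⟨hu, hθ⟩, hfix⟩ := exists_fixedPoint_box_prod_stdSimplex hR hmaps
    (hcont.mono (prod_mono_left (subset_univ _)))
  have hu : ∀ i, |u i| ≤ R := hu
  have hufix : ∀ i, max (-R) (min R (u i + v (u, θ) i)) = u i := fun i =>
    congrFun (congrArg Prod.fst hfix) i
  have hθfix : ∀ i, (θ i + max 0 (G (u, θ) i)) / (1 + ∑ k, max 0 (G (u, θ) k)) = θ i := fun i =>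
    congrFun (congrArg Prod.snd hfix) i
  refine ⟨u, θ, hθ, hu, fun i hi => ?_, fun i hi => ?_, fun i => ?_⟩
  · by_contra hne
    have hlt : u i < R := lt_of_le_of_ne (abs_le.1 (hu i)).2 hne
    have h1 : u i < min R (u i + v (u, θ) i) := lt_min hlt (by linarith)
    exact (h1.trans_le (le_max_right _ _)).ne (hufix i).symm
  · by_contra hne
    have hlt : -R < u i := lt_of_le_of_ne (abs_le.1 (hu i)).1 (Ne.symm hne)
    have h1 : min R (u i + v (u, θ) i) < u i := (min_le_right _ _).trans_lt (by linarith)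
    exact (max_lt hlt h1).ne (hufix i)
  · have := (div_eq_iff (hS (u, θ)).ne').1 (hθfix i)
    linarith

theorem IsRunningCost.continuousOn_inflow (hc : IsRunningCost c) (i : Fin d) :
    ContinuousOn (fun p : (Fin d → ℝ) × (Fin d → ℝ) =>
      ∑ j, p.2 j * αStar c (diffOp j p.1) p.2 j i) (univ ×ˢ stdSimplex ℝ (Fin d)) := by
  have hterm : ∀ j, ContinuousOn (fun p : (Fin d → ℝ) × (Fin d → ℝ) =>
      αStar c (diffOp j p.1) p.2 j i) (univ ×ˢ stdSimplex ℝ (Fin d)) := by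
    intro j
    have hpair : Continuous fun p : (Fin d → ℝ) × (Fin d → ℝ) => (diffOp j p.1, p.2) :=
      ((continuous_diffOp j).comp continuous_fst).prodMk continuous_snd
    have hmaps : MapsTo (fun p : (Fin d → ℝ) × (Fin d → ℝ) => (diffOp j p.1, p.2))
        (univ ×ˢ stdSimplex ℝ (Fin d)) (univ ×ˢ stdSimplex ℝ (Fin d)) :=
      fun p hp => ⟨mem_univ _, hp.2⟩
    have := (hc.continuousOn_αStar j i).comp hpair.continuousOn hmaps
    simpa only [Function.comp_def] using this
  have hcoord : ∀ j, ContinuousOn (fun p : (Fin d → ℝ) × (Fin d → ℝ) => p.2 j)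
      (univ ×ˢ stdSimplex ℝ (Fin d)) := fun j =>
    ((continuous_apply j).comp continuous_snd).continuousOn
  exact continuousOn_finsetSum _ fun j _ => (hcoord j).mul (hterm j)

theorem IsRunningCost.exists_isStationarySolution [Nonempty (Fin d)] (hc : IsRunningCost c)
    (hh : IsContractive c) : ∃ (θ u : Fin d → ℝ) (κ : ℝ), IsStationarySolution c θ u κ := by
  obtain ⟨M, hM0, hM⟩ := hh
  have hdpos : (0 : ℝ) < d := by exact_mod_cast Fin.pos_iff_nonempty.2 ‹_›
  have hv : ∀ i, ContinuousOn (fun p : (Fin d → ℝ) × (Fin d → ℝ) =>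
      h c p.1 p.2 i - (1 / (d : ℝ)) * ∑ j, h c p.1 p.2 j) (univ ×ˢ stdSimplex ℝ (Fin d)) := fun i =>
    (hc.continuousOn_h i).sub (continuousOn_const.mul
      (continuousOn_finsetSum _ fun j _ => hc.continuousOn_h j))
  obtain ⟨u, θ, hθ, hu, hvpos, hvneg, hG⟩ := exists_equilibrium_box_prod_stdSimplex
    -- Coordinates at opposite faces of this box force `sharpNorm u ≥ M + 1`, within reach of
    -- contractivity.
    (R := M + 1) (by linarith) hv hc.continuousOn_inflow
  simp only at hvpos hvneg hG
  have hvsum : ∑ i, (h c u θ i - (1 / (d : ℝ)) * ∑ j, h c u θ j) = 0 := by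
    rw [Finset.sum_sub_distrib, Finset.sum_const, Finset.card_univ, Fintype.card_fin, nsmul_eq_mul,
      ← mul_assoc, mul_one_div_cancel hdpos.ne', one_mul, sub_self]
  have hvle : ∀ i ∈ Finset.univ, h c u θ i - (1 / (d : ℝ)) * ∑ j, h c u θ j ≤ 0 := by
    intro i _
    by_contra! hi
    -- Deviations from the average sum to zero, so a positive one at `i` comes with a negative one
    -- at `j`. Then `u i` is the top and `u j` the bottom of the box, and contractivity makes the
    -- deviation at `i` negative.
    obtain ⟨j, hj⟩ : ∃ j, h c u θ j - (1 / (d : ℝ)) * ∑ j, h c u θ j < 0 := by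
      by_contra! hall
      exact (Finset.sum_pos' (fun j _ => hall j) ⟨i, Finset.mem_univ i, hi⟩).ne' hvsum
    have hui := hvpos i hi
    have huj := hvneg j hj
    have hsharp := sub_div_two_le_sharpNorm u i j
    have := (hM θ hθ i u (by linarith)).1 fun k =>
      sub_nonpos.2 (hui ▸ (abs_le.1 (hu k)).2)
    rw [h_diffOp] at this
    exact absurd hi (not_lt.2 this.le)
  have hv0 := (Finset.sum_eq_zero_iff_of_nonpos hvle).1 hvsum
  refine ⟨θ, u, (1 / (d : ℝ)) * ∑ j, h c u θ j, hθ, ?_, fun i => ?_⟩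
  · refine eq_zero_of_posPart_eq_mul ?_ ?_ hθ.1 hG
    · rw [Finset.sum_comm]
      refine Finset.sum_eq_zero fun j _ => ?_
      rw [← Finset.mul_sum, sum_αStar, mul_zero]
    -- An empty state has no outflow, so only nonnegative incoming rates remain.
    · intro i hi
      refine Finset.sum_nonneg fun j _ => ?_
      by_cases hij : i = j
      · simp only [← hij, hi, zero_mul, le_refl]
      · exact mul_nonneg (hθ.1 j) (hc.αStar_nonneg hθ _ hij)
  · rw [h_diffOp]
    exact sub_eq_zero.1 (hv0 i (Finset.mem_univ i))

end MeanFieldGame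

theorem proposition2p8 (d : ℕ) (hd : 1 ≤ d)
    (c : Fin d → (Fin d → ℝ) → (Fin d → ℝ) → ℝ)
    (hc : MeanFieldGame.IsRunningCost c) (hh : MeanFieldGame.IsContractive c) :
    (∃ M₀ : ℝ, ∀ M : ℝ, M₀ ≤ M →
      MeanFieldGame.IsBackwardInvariant c
        ({u : Fin d → ℝ | MeanFieldGame.sharpNorm u < M} ×ˢ stdSimplex ℝ (Fin d))) ∧
    (∃ (θ u : Fin d → ℝ) (κ : ℝ), MeanFieldGame.IsStationarySolution c θ u κ) := by
  have : Nonempty (Fin d) := Fin.pos_iff_nonempty.1 hd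
  exact ⟨hh.exists_isBackwardInvariant, hc.exists_isStationarySolution hh⟩
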